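/- **Setting.** Let $\mathbb H$ be the real quaternions, $\mathbb S=\{I\in\mathbb H: I^2=-1\}$, and let $\mathbb C\otimes_{\mathbb R}\mathbb H=\{w_0+\sqrt{-1}\,w_1: w_0,w_1\in\mathbb H\}$ be the complexified quaternion algebra, with conjugation $\overline{w_0+\sqrt{-1}w_1}=w_0-\sqrt{-1}w_1$. Using the basis $1,i,j,k$ we identify it with $\mathbb C^4$, with coordinates $(z_0,z_1,z_2,z_3)$. Put $$\Omega=\{z\in\mathbb C^4:\ z_1^2+z_2^2+z_3^2\neq 0,\ z_0^2+z_1^2+z_2^2+z_3^2\neq 0,\ z_0\neq 0\}.$$ Let $\mathcal U\subset\mathbb C$ be an open set that is symmetric under complex conjugation, has no real points, and whose upper half $\mathcal U^+=\{z\in\mathcal U:\operatorname{Im}z>0\}$ is a simply connected domain (so $\mathcal U^-=\overline{\mathcal U^+}$ is one too). Let $U=\{\alpha+I\beta:\alpha+\imath\beta\in\mathcal U,\ I\in\mathbb S\}\subset\mathbb H$. A *stem function* is a map $F=F_0+\sqrt{-1}F_1:\mathcal U\to\mathbb C\otimes\mathbb H$ with $F(\bar z)=\overline{F(z)}$. It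 induces the *slice function* $\mathcal I(F):U\to\mathbb H$, $\mathcal I(F)(\alpha+I\beta)=F_0(\alpha+\imath\beta)+I\,F_1(\alpha+\imath\beta)$; the slice function is *slice regular* if $F$ is holomorphic. The stem function of a slice function is unique, and the $\star$-product is $\mathcal I(F)\star\mathcal I(G)=\mathcal I(FG)$; $g^{\star k}$ is the $k$-th power for it. **Theorem.** Let $k\ge 1$ and let $f=\mathcal I(F):U\to\mathbb H$ be a slice function with $F(\mathcal U)\subset\Omega$. Then there are $k^2$ pairwise distinct slice functions $f_1,\dots,f_{k^2}:U\to\mathbb H$ such that $$(f_m)^{\star k}=f\qquad(m=1,\dots,k^2),$$ and they can be chosen so that moreover: 1. if $f$ is continuous, then every $f_m$ is continuous, and $f_1,\dots,f_{k^2}$ are all the continuous slice functions $h:U\to\mathbb H$ with $h^{\star k}=f$; furthermore each $f_m$ is induced by a stem function $F_m$ for which there is a continuous map $G_m:\mathcal U^+\to\mathbb C\otimes\mathbb H$ with $G_m(z)^k=F(z)$ on $\mathcal U^+$, $F_m(z)=G_m(z)$ for $z\in\mathcal U^+$ and $F_m(z)=\overline{G_m(\bar z)}$ for $z\in\mathcal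 U^-$; 2. if $f$ is slice regular, then every $f_m$ is slice regular. -/

import Mathlib

open scoped Quaternion ComplexConjugate

noncomputable section

namespace SliceFun

/-! The complexified quaternion algebra `ℂ ⊗ ℍ` is Mathlib's `ℍ[ℂ]`, the quaternions with complex
coefficients; an element `w` is written `w₀ + √-1 w₁` with `w₀, w₁ : ℍ[ℝ]`. -/

/-- The component `w₀` of `w = w₀ + √-1 w₁`. -/
def realPart (w : ℍ[ℂ]) : ℍ[ℝ] := ⟨w.re.re, w.imI.re, w.imJ.re, w.imK.re⟩

/-- The component `w₁` of `w = w₀ + √-1 w₁`. -/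
def imagPart (w : ℍ[ℂ]) : ℍ[ℝ] := ⟨w.re.im, w.imI.im, w.imJ.im, w.imK.im⟩

/-- The complex conjugation `w₀ + √-1 w₁ ↦ w₀ - √-1 w₁` (not the quaternionic one). -/
def cconj (w : ℍ[ℂ]) : ℍ[ℂ] := ⟨conj w.re, conj w.imI, conj w.imJ, conj w.imK⟩

/-- The identification of `ℂ ⊗ ℍ` with `ℂ⁴`. -/
def coords (w : ℍ[ℂ]) : Fin 4 → ℂ := ![w.re, w.imI, w.imJ, w.imK]

@[simp] theorem realPart_re (w : ℍ[ℂ]) : (realPart w).re = (w.re).re := rfl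
@[simp] theorem realPart_imI (w : ℍ[ℂ]) : (realPart w).imI = (w.imI).re := rfl
@[simp] theorem realPart_imJ (w : ℍ[ℂ]) : (realPart w).imJ = (w.imJ).re := rfl
@[simp] theorem realPart_imK (w : ℍ[ℂ]) : (realPart w).imK = (w.imK).re := rfl
@[simp] theorem imagPart_re (w : ℍ[ℂ]) : (imagPart w).re = (w.re).im := rfl
@[simp] theorem imagPart_imI (w : ℍ[ℂ]) : (imagPart w).imI = (w.imI).im := rfl
@[simp] theorem imagPart_imJ (w : ℍ[ℂ]) : (imagPart w).imJ = (w.imJ).im := rfl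
@[simp] theorem imagPart_imK (w : ℍ[ℂ]) : (imagPart w).imK = (w.imK).im := rfl
@[simp] theorem cconj_re (w : ℍ[ℂ]) : (cconj w).re = conj w.re := rfl
@[simp] theorem cconj_imI (w : ℍ[ℂ]) : (cconj w).imI = conj w.imI := rfl
@[simp] theorem cconj_imJ (w : ℍ[ℂ]) : (cconj w).imJ = conj w.imJ := rfl
@[simp] theorem cconj_imK (w : ℍ[ℂ]) : (cconj w).imK = conj w.imK := rfl

/-- The product of `ℍ[ℂ]` is `(v₀ + √-1 v₁)(w₀ + √-1 w₁) = v₀w₀ - v₁w₁ + √-1 (v₀w₁ + v₁w₀)`. -/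
theorem realPart_mul (v w : ℍ[ℂ]) :
    realPart (v * w) = realPart v * realPart w - imagPart v * imagPart w := by
  ext <;> simp <;> ring

theorem imagPart_mul (v w : ℍ[ℂ]) :
    imagPart (v * w) = realPart v * imagPart w + imagPart v * realPart w := by
  ext <;> simp <;> ring

theorem cconj_mul (v w : ℍ[ℂ]) : cconj (v * w) = cconj v * cconj w := by
  ext <;> simp

theorem cconj_one : cconj 1 = 1 := by
  ext <;> simp

/-- The sphere `𝕊` of imaginary units of the real quaternions. -/
def imagUnits : Set ℍ[ℝ] := {I | I ^ 2 = -1}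

/-- The point `α + I β` for `z = α + i β`. -/
def point (z : ℂ) (I : ℍ[ℝ]) : ℍ[ℝ] := (z.re : ℍ[ℝ]) + I * (z.im : ℍ[ℝ])

/-- The quaternion `w₀ + I w₁` for `w = w₀ + √-1 w₁`. -/
def evalAt (w : ℍ[ℂ]) (I : ℍ[ℝ]) : ℍ[ℝ] := realPart w + I * imagPart w

/-- The subset `{α + I β : α + i β ∈ 𝒰, I ∈ 𝕊}` of `ℍ`. -/
def circ (𝒰 : Set ℂ) : Set ℍ[ℝ] := {q | ∃ z ∈ 𝒰, ∃ I ∈ imagUnits, q = point z I}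

/-- `𝒰⁺`, the part of `𝒰` in the open upper half-plane. -/
def upper (𝒰 : Set ℂ) : Set ℂ := {z ∈ 𝒰 | 0 < z.im}

/-- `F` is a stem function on `𝒰`. -/
def IsStem (𝒰 : Set ℂ) (F : ℂ → ℍ[ℂ]) : Prop := ∀ z ∈ 𝒰, F (conj z) = cconj (F z)

/-- The function `ℐ(F)` on `circ 𝒰`, with `ℐ(F)(α + I β) = F₀(α + i β) + I F₁(α + i β)`. For a stem
function the value does not depend on the representation `α + I β` that is chosen: see
`sliceOf_point`. -/
def sliceOf (𝒰 : Set ℂ) (F : ℂ → ℍ[ℂ]) : circ 𝒰 → ℍ[ℝ] := fun q =>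
  evalAt (F q.2.choose) q.2.choose_spec.2.choose

theorem imagUnits_iff {I : ℍ[ℝ]} :
    I ∈ imagUnits ↔ I.re = 0 ∧ I.imI ^ 2 + I.imJ ^ 2 + I.imK ^ 2 = 1 := by
  constructor
  · intro h
    have h' : I * I = -1 := by rw [← sq]; exact h
    have e0 := congrArg (fun q : ℍ[ℝ] => q.re) h'
    have e1 := congrArg (fun q : ℍ[ℝ] => q.imI) h'
    have e2 := congrArg (fun q : ℍ[ℝ] => q.imJ) h'
    have e3 := congrArg (fun q : ℍ[ℝ] => q.imK) h'
    simp at e0 e1 e2 e3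
    have hr : I.re = 0 := by
      by_contra hne
      have a1 : I.imI = 0 := by
        have : I.re * I.imI = 0 := by linarith
        exact (mul_eq_zero.mp this).resolve_left hne
      have a2 : I.imJ = 0 := by
        have : I.re * I.imJ = 0 := by linarith
        exact (mul_eq_zero.mp this).resolve_left hne
      have a3 : I.imK = 0 := by
        have : I.re * I.imK = 0 := by linarith
        exact (mul_eq_zero.mp this).resolve_left hne
      rw [a1, a2, a3] at e0
      nlinarith [sq_nonneg I.re]
    refine ⟨hr, ?_⟩
    rw [hr] at e0
    linarith
  · rintro ⟨h0, h1⟩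
    change I ^ 2 = -1
    rw [sq]
    ext <;> simp [h0] <;> linarith

theorem evalAt_eq_of_point_eq {𝒰 : Set ℂ} {F : ℂ → ℍ[ℂ]} (hF : IsStem 𝒰 F) {z z' : ℂ}
    {I I' : ℍ[ℝ]} (hz : z ∈ 𝒰) (hI : I ∈ imagUnits) (hI' : I' ∈ imagUnits)
    (h : point z I = point z' I') : evalAt (F z) I = evalAt (F z') I' := by
  obtain ⟨r, s⟩ := imagUnits_iff.mp hI
  obtain ⟨r', s'⟩ := imagUnits_iff.mp hI'
  have e0 := congrArg (fun q : ℍ[ℝ] => q.re) h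
  have e1 := congrArg (fun q : ℍ[ℝ] => q.imI) h
  have e2 := congrArg (fun q : ℍ[ℝ] => q.imJ) h
  have e3 := congrArg (fun q : ℍ[ℝ] => q.imK) h
  simp [point, r, r'] at e0 e1 e2 e3
  have hsq : z'.im ^ 2 = z.im ^ 2 := by
    calc z'.im ^ 2 = (I'.imI * z'.im) ^ 2 + (I'.imJ * z'.im) ^ 2 + (I'.imK * z'.im) ^ 2 := by
          linear_combination (-z'.im ^ 2) * s'
      _ = z.im ^ 2 := by
          rw [← e1, ← e2, ← e3]; linear_combination (z.im ^ 2) * s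
  have hst := hF z hz
  rcases sq_eq_sq_iff_eq_or_eq_neg.mp hsq with hi | hi
  · have hzz : z' = z := Complex.ext e0.symm hi
    subst hzz
    by_cases h0 : z'.im = 0
    · have hc : conj z' = z' := Complex.conj_eq_iff_im.mpr h0
      rw [hc] at hst
      have him : imagPart (F z') = 0 := by
        have a0 := congrArg (fun q : ℍ[ℂ] => q.re.im) hst
        have a1 := congrArg (fun q : ℍ[ℂ] => q.imI.im) hst
        have a2 := congrArg (fun q : ℍ[ℂ] => q.imJ.im) hst
        have a3 := congrArg (fun q : ℍ[ℂ] => q.imK.im) hst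
        simp at a0 a1 a2 a3
        ext <;> simp <;> linarith
      simp [evalAt, him]
    · have hII : I = I' := by
        ext
        · rw [r, r']
        · exact mul_right_cancel₀ h0 e1
        · exact mul_right_cancel₀ h0 e2
        · exact mul_right_cancel₀ h0 e3
      rw [hII]
  · have hzz : z' = conj z := Complex.ext (by simpa using e0.symm) (by simpa using hi)
    subst hzz
    rw [hst]
    by_cases h0 : z.im = 0
    · have hc : conj z = z := Complex.conj_eq_iff_im.mpr h0
      rw [hc] at hst
      have him : imagPart (F z) = 0 := by
        have a0 := congrArg (fun q : ℍ[ℂ] => q.re.im) hst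
        have a1 := congrArg (fun q : ℍ[ℂ] => q.imI.im) hst
        have a2 := congrArg (fun q : ℍ[ℂ] => q.imJ.im) hst
        have a3 := congrArg (fun q : ℍ[ℂ] => q.imK.im) hst
        simp at a0 a1 a2 a3
        ext <;> simp <;> linarith
      rw [← hst]
      simp [evalAt, him]
    · rw [hi] at e1 e2 e3
      have hII : I' = -I := by
        ext
        · simp [r, r']
        · exact mul_right_cancel₀ h0 (by simp; linarith)
        · exact mul_right_cancel₀ h0 (by simp; linarith)
        · exact mul_right_cancel₀ h0 (by simp; linarith)
      have hcr : realPart (cconj (F z)) = realPart (F z) := by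
        ext <;> simp
      have hci : imagPart (cconj (F z)) = -imagPart (F z) := by
        ext <;> simp
      rw [hII, evalAt, evalAt, hcr, hci, neg_mul_neg]

/-- The defining property of `ℐ(F)` for a stem function `F`. -/
theorem sliceOf_point {𝒰 : Set ℂ} {F : ℂ → ℍ[ℂ]} (hF : IsStem 𝒰 F) {z : ℂ} {I : ℍ[ℝ]}
    (hz : z ∈ 𝒰) (hI : I ∈ imagUnits) (h : point z I ∈ circ 𝒰) :
    sliceOf 𝒰 F ⟨point z I, h⟩ = evalAt (F z) I :=
  (evalAt_eq_of_point_eq hF hz hI h.choose_spec.2.choose_spec.1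
    h.choose_spec.2.choose_spec.2).symm

/-- The stem function of a slice function is unique. -/
theorem stem_unique {𝒰 : Set ℂ} {F G : ℂ → ℍ[ℂ]} (hF : IsStem 𝒰 F) (hG : IsStem 𝒰 G)
    (h : sliceOf 𝒰 F = sliceOf 𝒰 G) {z : ℂ} (hz : z ∈ 𝒰) : F z = G z := by
  have key : ∀ I ∈ imagUnits, evalAt (F z) I = evalAt (G z) I := by
    intro I hI
    have hm : point z I ∈ circ 𝒰 := ⟨z, hz, I, hI, rfl⟩
    rw [← sliceOf_point hF hz hI hm, ← sliceOf_point hG hz hI hm, h]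
  obtain ⟨i, i0, i1, i2, i3⟩ : ∃ i : ℍ[ℝ], i.re = 0 ∧ i.imI = 1 ∧ i.imJ = 0 ∧ i.imK = 0 :=
    ⟨⟨0, 1, 0, 0⟩, rfl, rfl, rfl, rfl⟩
  have hi : i ∈ imagUnits := imagUnits_iff.mpr (by rw [i0, i1, i2, i3]; norm_num)
  have hi' : -i ∈ imagUnits := imagUnits_iff.mpr (by simp [i0, i1, i2, i3])
  have k1 := key _ hi
  have k2 := key _ hi'
  have x0 := congrArg (fun q : ℍ[ℝ] => q.re) k1
  have x1 := congrArg (fun q : ℍ[ℝ] => q.imI) k1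
  have x2 := congrArg (fun q : ℍ[ℝ] => q.imJ) k1
  have x3 := congrArg (fun q : ℍ[ℝ] => q.imK) k1
  have y0 := congrArg (fun q : ℍ[ℝ] => q.re) k2
  have y1 := congrArg (fun q : ℍ[ℝ] => q.imI) k2
  have y2 := congrArg (fun q : ℍ[ℝ] => q.imJ) k2
  have y3 := congrArg (fun q : ℍ[ℝ] => q.imK) k2
  simp [evalAt, i0, i1, i2, i3] at x0 x1 x2 x3 y0 y1 y2 y3
  ext <;> apply Complex.ext <;> linarith

/-- `f` is a slice function on `circ 𝒰`. -/
def IsSlice (𝒰 : Set ℂ) (f : circ 𝒰 → ℍ[ℝ]) : Prop := ∃ F, IsStem 𝒰 F ∧ f = sliceOf 𝒰 F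

/-- `f` is a slice regular function on `circ 𝒰`: it is induced by a holomorphic stem function. -/
def IsSliceRegular (𝒰 : Set ℂ) (f : circ 𝒰 → ℍ[ℝ]) : Prop :=
  ∃ F, IsStem 𝒰 F ∧ DifferentiableOn ℂ (fun z => coords (F z)) 𝒰 ∧ f = sliceOf 𝒰 F

open Classical in
/-- The stem function of a slice function (unique on `𝒰`, see `stem_unique`). -/
def stemOf (𝒰 : Set ℂ) (f : circ 𝒰 → ℍ[ℝ]) : ℂ → ℍ[ℂ] :=
  if h : IsSlice 𝒰 f then h.choose else 0

/-- The `⋆`-product `ℐ(F) ⋆ ℐ(G) = ℐ(FG)` of slice functions. -/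
def starMul (𝒰 : Set ℂ) (f g : circ 𝒰 → ℍ[ℝ]) : circ 𝒰 → ℍ[ℝ] :=
  sliceOf 𝒰 (fun z => stemOf 𝒰 f z * stemOf 𝒰 g z)

/-- The `k`-th `⋆`-power of a slice function. -/
def starPow (𝒰 : Set ℂ) (f : circ 𝒰 → ℍ[ℝ]) : ℕ → circ 𝒰 → ℍ[ℝ]
  | 0 => fun _ => 1
  | k + 1 => starMul 𝒰 (starPow 𝒰 f k) f

theorem sliceOf_congr {𝒰 : Set ℂ} {F G : ℂ → ℍ[ℂ]} (h : ∀ z ∈ 𝒰, F z = G z) :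
    sliceOf 𝒰 F = sliceOf 𝒰 G := by
  funext q
  simp only [sliceOf]
  rw [h _ q.2.choose_spec.1]

theorem stemOf_sliceOf {𝒰 : Set ℂ} {F : ℂ → ℍ[ℂ]} (hF : IsStem 𝒰 F) {z : ℂ} (hz : z ∈ 𝒰) :
    stemOf 𝒰 (sliceOf 𝒰 F) z = F z := by
  have h : IsSlice 𝒰 (sliceOf 𝒰 F) := ⟨F, hF, rfl⟩
  rw [stemOf, dif_pos h]
  exact (stem_unique hF h.choose_spec.1 h.choose_spec.2 hz).symm

theorem starMul_sliceOf {𝒰 : Set ℂ} {F G : ℂ → ℍ[ℂ]} (hF : IsStem 𝒰 F) (hG : IsStem 𝒰 G) :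
    starMul 𝒰 (sliceOf 𝒰 F) (sliceOf 𝒰 G) = sliceOf 𝒰 (fun z => F z * G z) :=
  sliceOf_congr fun _ hz => by rw [stemOf_sliceOf hF hz, stemOf_sliceOf hG hz]

theorem IsStem.pow {𝒰 : Set ℂ} {F : ℂ → ℍ[ℂ]} (hF : IsStem 𝒰 F) (k : ℕ) :
    IsStem 𝒰 (fun z => F z ^ k) := by
  intro z hz
  induction k with
  | zero => simp [cconj_one]
  | succ k ih => simp only [pow_succ, cconj_mul] at ih ⊢; rw [ih, hF z hz]

theorem starPow_sliceOf {𝒰 : Set ℂ} {F : ℂ → ℍ[ℂ]} (hF : IsStem 𝒰 F) (k : ℕ) :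
    starPow 𝒰 (sliceOf 𝒰 F) k = sliceOf 𝒰 (fun z => F z ^ k) := by
  induction k with
  | zero =>
    funext q
    have h0 : realPart (1 : ℍ[ℂ]) = 1 := by ext <;> simp
    have h1 : imagPart (1 : ℍ[ℂ]) = 0 := by ext <;> simp
    simp [starPow, sliceOf, evalAt, h0, h1]
  | succ k ih =>
    rw [starPow, ih, starMul_sliceOf (hF.pow k) hF]
    simp only [pow_succ]

/-- The set `Ω ⊆ ℂ ⊗ ℍ ≃ ℂ⁴` of the points `(z₀, z₁, z₂, z₃)` with `z₁² + z₂² + z₃² ≠ 0`,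
`z₀² + z₁² + z₂² + z₃² ≠ 0` and `z₀ ≠ 0`. -/
def Omega : Set ℍ[ℂ] :=
  {w | w.imI ^ 2 + w.imJ ^ 2 + w.imK ^ 2 ≠ 0 ∧
    w.re ^ 2 + (w.imI ^ 2 + w.imJ ^ 2 + w.imK ^ 2) ≠ 0 ∧ w.re ≠ 0}

/-- The `k`-th power map `σ_k` of `ℂ ⊗ ℍ`. -/
def sigma (k : ℕ) (w : ℍ[ℂ]) : ℍ[ℂ] := w ^ k

/-- The extension of a function `G` on `𝒰⁺` to `𝒰` by `z ↦ conj (G (conj z))` on `𝒰⁻`. -/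
def glue (G : ℂ → ℍ[ℂ]) : ℂ → ℍ[ℂ] := fun z => if 0 < z.im then G z else cconj (G (conj z))

end SliceFun

end

noncomputable section

namespace SliceFun

/-! Write `w = z₀ + v` with `v` the vector part. Then `v² = -s²` with `s² = z₁² + z₂² + z₃²`, so for
`s ≠ 0` the algebra `ℂ[w]` is `ℂ × ℂ`, and `w` corresponds to the pair of eigenvalues `z₀ ± √-1 s`.
A `k`-th root of `w` commutes with `w`, hence lies in `ℂ[w]` (`ofEigen_eigen`), hence is a pair of
`k`-th roots of the eigenvalues (`eigen_pow`). On `Ω` the eigenvalues are nonzero, so there are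
exactly `k²` roots.

Over the simply connected `𝒰⁺` the functions `s`, `a`, `b` (a square root of `vecSq F` and `k`-th
roots of the two eigenvalues) can be taken continuous when `F` is (`exists_root`). Multiplying `a`
and `b` independently by `k`-th roots of unity gives `k²` branches, which `glue` carries to `𝒰⁻` by
conjugation. A continuous root has continuous eigenvalues, which differ from `a` and `b` by constant
roots of unity (`exists_eq_pow_mul`), so nothing else occurs. Holomorphy is inherited by continuous
roots (`differentiableOn_of_pow`). -/

/-- The sum of the squares of the vector components of `w`. -/
def vecSq (w : ℍ[ℂ]) : ℂ := w.imI ^ 2 + w.imJ ^ 2 + w.imK ^ 2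

/-- The bilinear dot product of the vector parts. -/
def vecDot (v w : ℍ[ℂ]) : ℂ := v.imI * w.imI + v.imJ * w.imJ + v.imK * w.imK

/-- The element of `ℂ[w]` with eigenvalues `x` and `y`; here `s` is a square root of `vecSq w`. -/
def ofEigen (w : ℍ[ℂ]) (s x y : ℂ) : ℍ[ℂ] :=
  ⟨(x + y) / 2, (x - y) / (2 * Complex.I * s) * w.imI, (x - y) / (2 * Complex.I * s) * w.imJ,
    (x - y) / (2 * Complex.I * s) * w.imK⟩

/-- The eigenvalue of `h` belonging to the square root `s` of `vecSq w`, for `h` in `ℂ[w]`. -/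
def eigen (w : ℍ[ℂ]) (s : ℂ) (h : ℍ[ℂ]) : ℂ := h.re + Complex.I * (vecDot w h / s)

@[simp] theorem ofEigen_re (w : ℍ[ℂ]) (s x y : ℂ) : (ofEigen w s x y).re = (x + y) / 2 := rfl
@[simp] theorem ofEigen_imI (w : ℍ[ℂ]) (s x y : ℂ) :
    (ofEigen w s x y).imI = (x - y) / (2 * Complex.I * s) * w.imI := rfl
@[simp] theorem ofEigen_imJ (w : ℍ[ℂ]) (s x y : ℂ) :
    (ofEigen w s x y).imJ = (x - y) / (2 * Complex.I * s) * w.imJ := rfl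
@[simp] theorem ofEigen_imK (w : ℍ[ℂ]) (s x y : ℂ) :
    (ofEigen w s x y).imK = (x - y) / (2 * Complex.I * s) * w.imK := rfl

/-! ### The algebra `ℂ[w] ≃ ℂ × ℂ` and its `k`-th roots. -/

section Algebra

variable {w : ℍ[ℂ]} {s : ℂ}

/-- The vector part of `w` squares to `-s²`, so it acts as `√-1 s` on one factor of `ℂ × ℂ` and as
`-√-1 s` on the other. -/
theorem ofEigen_mul (hs : s ^ 2 = vecSq w) (h0 : s ≠ 0) (x y x' y' : ℂ) :
    ofEigen w s x y * ofEigen w s x' y' = ofEigen w s (x * x') (y * y') := by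
  rw [vecSq] at hs
  have hI := Complex.I_sq
  have hI0 := Complex.I_ne_zero
  ext
  · simp only [Quaternion.re_mul, ofEigen_re, ofEigen_imI, ofEigen_imJ, ofEigen_imK]
    have : (x - y) / (2 * Complex.I * s) * ((x' - y') / (2 * Complex.I * s)) * s ^ 2
        = - ((x - y) * (x' - y') / 4) := by
      field_simp
      rw [hI]; ring
    rw [hs] at this
    linear_combination -this
  all_goals
    simp only [Quaternion.imI_mul, Quaternion.imJ_mul, Quaternion.imK_mul, ofEigen_re,
      ofEigen_imI, ofEigen_imJ, ofEigen_imK]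
    ring

theorem ofEigen_one : ofEigen w s 1 1 = 1 := by
  ext <;> simp

theorem ofEigen_pow (hs : s ^ 2 = vecSq w) (h0 : s ≠ 0) (x y : ℂ) (k : ℕ) :
    ofEigen w s x y ^ k = ofEigen w s (x ^ k) (y ^ k) := by
  induction k with
  | zero => simp [ofEigen_one]
  | succ k ih => rw [pow_succ, ih, ofEigen_mul hs h0, pow_succ, pow_succ]

theorem ofEigen_self (h0 : s ≠ 0) :
    ofEigen w s (w.re + Complex.I * s) (w.re - Complex.I * s) = w := by
  have hI0 := Complex.I_ne_zero
  have h : (w.re + Complex.I * s - (w.re - Complex.I * s)) / (2 * Complex.I * s) = 1 := by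
    field_simp; ring
  ext
  · rw [ofEigen_re]; ring
  all_goals simp only [ofEigen_imI, ofEigen_imJ, ofEigen_imK, h, one_mul]

theorem eigen_ofEigen (hs : s ^ 2 = vecSq w) (h0 : s ≠ 0) (x y : ℂ) :
    eigen w s (ofEigen w s x y) = x := by
  have hI0 := Complex.I_ne_zero
  have h : vecDot w (ofEigen w s x y) = (x - y) / (2 * Complex.I * s) * s ^ 2 := by
    rw [hs, vecSq, vecDot]; simp only [ofEigen_imI, ofEigen_imJ, ofEigen_imK]; ring
  rw [eigen, h, ofEigen_re]
  field_simp
  ring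

/-- Passing from `s` to `-s` exchanges the two factors, so `eigen` serves for both coordinates. -/
theorem eigen_neg_ofEigen (hs : s ^ 2 = vecSq w) (h0 : s ≠ 0) (x y : ℂ) :
    eigen w (-s) (ofEigen w s x y) = y := by
  have hI0 := Complex.I_ne_zero
  have h : vecDot w (ofEigen w s x y) = (x - y) / (2 * Complex.I * s) * s ^ 2 := by
    rw [hs, vecSq, vecDot]; simp only [ofEigen_imI, ofEigen_imJ, ofEigen_imK]; ring
  rw [eigen, h, ofEigen_re]
  field_simp
  ring

/-- An element commuting with `w` lies in `ℂ[w]` when `w` has non-isotropic vector part. -/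
theorem ofEigen_eigen (hs : s ^ 2 = vecSq w) (h0 : s ≠ 0) {h : ℍ[ℂ]} (hc : Commute w h) :
    ofEigen w s (eigen w s h) (eigen w (-s) h) = h := by
  have hI0 := Complex.I_ne_zero
  have e1 := congrArg (fun q : ℍ[ℂ] => q.imI) hc.eq
  have e2 := congrArg (fun q : ℍ[ℂ] => q.imJ) hc.eq
  have e3 := congrArg (fun q : ℍ[ℂ] => q.imK) hc.eq
  simp only [Quaternion.imI_mul, Quaternion.imJ_mul, Quaternion.imK_mul] at e1 e2 e3
  have hd : (eigen w s h - eigen w (-s) h) / (2 * Complex.I * s) = vecDot w h / s ^ 2 := by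
    rw [eigen, eigen]; field_simp; ring
  have hs0 : vecSq w ≠ 0 := hs ▸ pow_ne_zero 2 h0
  ext
  · rw [ofEigen_re, eigen, eigen]; field_simp; ring
  all_goals
    simp only [ofEigen_imI, ofEigen_imJ, ofEigen_imK, hd]
    rw [hs, div_mul_eq_mul_div, div_eq_iff hs0, vecDot, vecSq]
  -- With `v`, `u` the vector parts of `w`, `h`, commutation says `v × u = 0`; the goals are the
  -- components of `(v·u) v - (v·v) u = v × (v × u) = 0`.
  · linear_combination (w.imJ / 2) * e3 + (-w.imK / 2) * e2
  · linear_combination (-w.imI / 2) * e3 + (w.imK / 2) * e1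
  · linear_combination (w.imI / 2) * e2 + (-w.imJ / 2) * e1

theorem eigen_pow (hs : s ^ 2 = vecSq w) (h0 : s ≠ 0) {h : ℍ[ℂ]} {k : ℕ} (hk : h ^ k = w) :
    eigen w s h ^ k = w.re + Complex.I * s ∧ eigen w (-s) h ^ k = w.re - Complex.I * s := by
  have hc : Commute w h := hk ▸ Commute.pow_self h k
  have key : ofEigen w s (eigen w s h ^ k) (eigen w (-s) h ^ k)
      = ofEigen w s (w.re + Complex.I * s) (w.re - Complex.I * s) := by
    rw [← ofEigen_pow hs h0, ofEigen_eigen hs h0 hc, ofEigen_self h0, hk]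
  have k1 := congrArg (eigen w s) key
  have k2 := congrArg (eigen w (-s)) key
  rw [eigen_ofEigen hs h0, eigen_ofEigen hs h0] at k1
  rw [eigen_neg_ofEigen hs h0, eigen_neg_ofEigen hs h0] at k2
  exact ⟨k1, k2⟩

end Algebra

/-! ### Roots of scalar functions: holomorphy and rigidity. -/

/-- The power map is locally invertible away from `0`; continuity keeps `f` on the branch of the
local inverse through `f a`. -/
theorem differentiableOn_of_pow {U : Set ℂ} (hU : IsOpen U) {f : ℂ → ℂ} {n : ℕ} (hn : n ≠ 0)
    (hf : ContinuousOn f U) (h0 : ∀ z ∈ U, f z ≠ 0) (hp : DifferentiableOn ℂ (fun z => f z ^ n) U) :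
    DifferentiableOn ℂ f U := by
  intro a ha
  have hUa := hU.mem_nhds ha
  have hd : HasStrictDerivAt (fun x : ℂ => x ^ n) (n * f a ^ (n - 1)) (f a) :=
    hasStrictDerivAt_pow n (f a)
  have hc : (n * f a ^ (n - 1) : ℂ) ≠ 0 :=
    mul_ne_zero (Nat.cast_ne_zero.mpr hn) (pow_ne_zero _ (h0 a ha))
  have hinv : DifferentiableAt ℂ (hd.localInverse _ _ _ hc) (f a ^ n) :=
    (hd.to_localInverse hc).hasDerivAt.differentiableAt
  have hcomp : DifferentiableAt ℂ (fun z => hd.localInverse _ _ _ hc (f z ^ n)) a :=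
    DifferentiableAt.comp (g := hd.localInverse _ _ _ hc) a hinv (hp.differentiableAt hUa)
  have hev := (hf.continuousAt hUa).eventually
    ((hd.hasStrictFDerivAt_equiv hc).eventually_left_inverse)
  exact (hcomp.congr_of_eventuallyEq (hev.mono fun z hz => hz.symm)).differentiableWithinAt

/-- Continuous `k`-th roots of the same nonvanishing function on a preconnected set differ by a
constant `k`-th root of unity. -/
theorem exists_eq_pow_mul {U : Set ℂ} (hU : IsPreconnected U) {k : ℕ} (hk : k ≠ 0) {ζ : ℂ}
    (hζ : IsPrimitiveRoot ζ k) {a b : ℂ → ℂ} (ha : ContinuousOn a U) (hb : ContinuousOn b U)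
    (h0 : ∀ z ∈ U, a z ≠ 0) (h : ∀ z ∈ U, b z ^ k = a z ^ k) :
    ∃ i : Fin k, ∀ z ∈ U, b z = ζ ^ (i : ℕ) * a z := by
  have : NeZero k := ⟨hk⟩
  have hfin : ({x : ℂ | x ^ k = 1}).Finite := by
    refine (Set.finite_range fun i : Fin k => ζ ^ (i : ℕ)).subset ?_
    intro x hx
    obtain ⟨i, hi, e⟩ := hζ.eq_pow_of_pow_eq_one hx
    exact ⟨⟨i, hi⟩, e⟩
  -- The quotient `b / a` is continuous with values in a finite, hence discrete, set.
  obtain ⟨y, hy, he⟩ := hU.eqOn_const_of_mapsTo (T := {x : ℂ | x ^ k = 1}) hfin.isDiscrete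
    (hb.div ha h0)
    (fun z hz => by
      simp only [Set.mem_ofPred_eq, Pi.div_apply, div_pow, h z hz]
      exact div_self (pow_ne_zero _ (h0 z hz)))
    ⟨1, one_pow k⟩
  obtain ⟨i, hi, rfl⟩ := hζ.eq_pow_of_pow_eq_one hy
  refine ⟨⟨i, hi⟩, fun z hz => ?_⟩
  have := he hz
  simp only [Pi.div_apply, Function.const_apply] at this
  exact (div_eq_iff (h0 z hz)).mp this

/-! ### Coordinates, and extension from `𝒰⁺` to `𝒰` by conjugation. -/

theorem cconj_cconj (w : ℍ[ℂ]) : cconj (cconj w) = w := by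
  ext <;> simp

theorem continuousOn_coords_iff {X : Type*} [TopologicalSpace X] {U : Set X} {F : X → ℍ[ℂ]} :
    ContinuousOn (fun z => coords (F z)) U ↔
      ContinuousOn (fun z => (F z).re) U ∧ ContinuousOn (fun z => (F z).imI) U ∧
      ContinuousOn (fun z => (F z).imJ) U ∧ ContinuousOn (fun z => (F z).imK) U := by
  simp [continuousOn_pi, Fin.forall_fin_succ, coords]

theorem differentiableOn_coords_iff {U : Set ℂ} {F : ℂ → ℍ[ℂ]} :
    DifferentiableOn ℂ (fun z => coords (F z)) U ↔
      DifferentiableOn ℂ (fun z => (F z).re) U ∧ DifferentiableOn ℂ (fun z => (F z).imI) U ∧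
      DifferentiableOn ℂ (fun z => (F z).imJ) U ∧ DifferentiableOn ℂ (fun z => (F z).imK) U := by
  simp [differentiableOn_pi, Fin.forall_fin_succ, coords]

theorem continuous_quaternion_iff {X : Type*} [TopologicalSpace X] {f : X → ℍ[ℝ]} :
    Continuous f ↔ Continuous (fun x => (f x).re) ∧ Continuous (fun x => (f x).imI) ∧
      Continuous (fun x => (f x).imJ) ∧ Continuous (fun x => (f x).imK) := by
  refine ⟨fun h => ⟨Quaternion.continuous_re.comp h, Quaternion.continuous_imI.comp h,
    Quaternion.continuous_imJ.comp h, Quaternion.continuous_imK.comp h⟩, ?_⟩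
  rintro ⟨h0, h1, h2, h3⟩
  rw [← Quaternion.linearIsometryEquivTuple.comp_continuous_iff]
  refine (PiLp.continuous_toLp 2 _).comp (continuous_pi fun i => ?_)
  fin_cases i <;> assumption

theorem IsStem.eqOn {𝒰 : Set ℂ} (hsymm : ∀ z ∈ 𝒰, conj z ∈ 𝒰) (hreal : ∀ z ∈ 𝒰, z.im ≠ 0)
    {F G : ℂ → ℍ[ℂ]} (hF : IsStem 𝒰 F) (hG : IsStem 𝒰 G) (h : ∀ z ∈ upper 𝒰, F z = G z) :
    ∀ z ∈ 𝒰, F z = G z := by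
  intro z hz
  rcases lt_or_gt_of_ne (hreal z hz) with hi | hi
  · have hc : conj z ∈ upper 𝒰 := ⟨hsymm z hz, by simpa using hi⟩
    rw [← Complex.conj_conj z, hF _ hc.1, hG _ hc.1, h _ hc]
  · exact h z ⟨hz, hi⟩

theorem glue_of_im_pos {G : ℂ → ℍ[ℂ]} {z : ℂ} (hz : 0 < z.im) : glue G z = G z := if_pos hz

theorem glue_of_im_neg {G : ℂ → ℍ[ℂ]} {z : ℂ} (hz : z.im < 0) :
    glue G z = cconj (G (conj z)) := if_neg hz.not_gt

theorem isStem_glue {𝒰 : Set ℂ} (hreal : ∀ z ∈ 𝒰, z.im ≠ 0) (G : ℂ → ℍ[ℂ]) :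
    IsStem 𝒰 (glue G) := by
  intro z hz
  rcases lt_or_gt_of_ne (hreal z hz) with hi | hi
  · rw [glue_of_im_neg hi, cconj_cconj, glue_of_im_pos (by simpa using hi)]
  · rw [glue_of_im_pos hi, glue_of_im_neg (by simpa using hi), Complex.conj_conj]

theorem isOpen_upper {𝒰 : Set ℂ} (hopen : IsOpen 𝒰) : IsOpen (upper 𝒰) :=
  hopen.inter (isOpen_lt continuous_const Complex.continuous_im)

/-- On the lower half each coordinate is `z ↦ conj (g (conj z))`, holomorphic by reflection. Since
`𝒰` misses the real axis, no matching across it is needed. -/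
theorem differentiableOn_glue {𝒰 : Set ℂ} (hopen : IsOpen 𝒰) (hsymm : ∀ z ∈ 𝒰, conj z ∈ 𝒰)
    (hreal : ∀ z ∈ 𝒰, z.im ≠ 0) {G : ℂ → ℍ[ℂ]}
    (hG : DifferentiableOn ℂ (fun z => coords (G z)) (upper 𝒰)) :
    DifferentiableOn ℂ (fun z => coords (glue G z)) 𝒰 := by
  intro z hz
  refine DifferentiableAt.differentiableWithinAt ?_
  rcases lt_or_gt_of_ne (hreal z hz) with hi | hi
  · have hc : conj z ∈ upper 𝒰 := ⟨hsymm z hz, by simpa using hi⟩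
    have hd := hG.differentiableAt ((isOpen_upper hopen).mem_nhds hc)
    have hev : (fun z => coords (glue G z)) =ᶠ[nhds z]
        fun z => coords (cconj (G (conj z))) := by
      filter_upwards [(isOpen_lt Complex.continuous_im continuous_const).mem_nhds hi] with x hx
      rw [glue_of_im_neg hx]
    refine DifferentiableAt.congr_of_eventuallyEq ?_ hev
    rw [differentiableAt_pi] at hd ⊢
    intro i
    have := (hd i).conj_conj
    rw [Complex.conj_conj] at this
    refine this.congr_of_eventuallyEq (Filter.Eventually.of_forall fun x => ?_)
    fin_cases i <;> rfl
  · have hd := hG.differentiableAt ((isOpen_upper hopen).mem_nhds ⟨hz, hi⟩)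
    refine hd.congr_of_eventuallyEq ?_
    filter_upwards [(isOpen_lt continuous_const Complex.continuous_im).mem_nhds hi] with x hx
    rw [glue_of_im_pos hx]

/-! ### Continuity of a slice function and of its stem function. -/

/-- The norm of the vector part of a real quaternion. -/
def imNorm (q : ℍ[ℝ]) : ℝ := √(q.imI ^ 2 + q.imJ ^ 2 + q.imK ^ 2)

/-- The normalised vector part of a real quaternion. -/
def imDir (q : ℍ[ℝ]) : ℍ[ℝ] := ⟨0, q.imI / imNorm q, q.imJ / imNorm q, q.imK / imNorm q⟩

@[simp] theorem imDir_re (q : ℍ[ℝ]) : (imDir q).re = 0 := rfl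
@[simp] theorem imDir_imI (q : ℍ[ℝ]) : (imDir q).imI = q.imI / imNorm q := rfl
@[simp] theorem imDir_imJ (q : ℍ[ℝ]) : (imDir q).imJ = q.imJ / imNorm q := rfl
@[simp] theorem imDir_imK (q : ℍ[ℝ]) : (imDir q).imK = q.imK / imNorm q := rfl

theorem continuous_imNorm : Continuous imNorm := by
  have := Quaternion.continuous_imI
  have := Quaternion.continuous_imJ
  have := Quaternion.continuous_imK
  unfold imNorm
  fun_prop

theorem imNorm_point (z : ℂ) {I : ℍ[ℝ]} (hI : I ∈ imagUnits) : imNorm (point z I) = |z.im| := by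
  obtain ⟨-, h⟩ := imagUnits_iff.mp hI
  rw [imNorm, ← Real.sqrt_sq_eq_abs]
  congr 1
  simp [point]
  linear_combination z.im ^ 2 * h

theorem imDir_mem {q : ℍ[ℝ]} (hq : imNorm q ≠ 0) : imDir q ∈ imagUnits := by
  refine imagUnits_iff.mpr ⟨rfl, ?_⟩
  have h : imNorm q ^ 2 = q.imI ^ 2 + q.imJ ^ 2 + q.imK ^ 2 := Real.sq_sqrt (by positivity)
  simp only [imDir]
  field_simp
  exact h.symm

theorem point_imDir {q : ℍ[ℝ]} (hq : imNorm q ≠ 0) : point ⟨q.re, imNorm q⟩ (imDir q) = q := by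
  ext <;> simp [point, hq]

/-- The slice coordinate of a point of `circ 𝒰` with positive imaginary part lies in `𝒰⁺`. -/
theorem mem_upper_of_mem_circ {𝒰 : Set ℂ} (hsymm : ∀ z ∈ 𝒰, conj z ∈ 𝒰)
    (hreal : ∀ z ∈ 𝒰, z.im ≠ 0) {q : ℍ[ℝ]} (hq : q ∈ circ 𝒰) :
    (⟨q.re, imNorm q⟩ : ℂ) ∈ upper 𝒰 := by
  obtain ⟨z, hz, I, hI, rfl⟩ := hq
  have hr : (point z I).re = z.re := by simp [point, (imagUnits_iff.mp hI).1]
  rw [imNorm_point z hI, hr]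
  refine ⟨?_, abs_pos.mpr (hreal z hz)⟩
  rcases abs_choice z.im with h | h <;> rw [h]
  · exact hz
  · exact hsymm z hz

/-- Away from the real axis, `q` has the representation with `β = |Im q|` and `I = Im q / |Im q|`,
which depends continuously on `q` and only uses `F` on `𝒰⁺`. -/
theorem continuous_sliceOf {𝒰 : Set ℂ} (hsymm : ∀ z ∈ 𝒰, conj z ∈ 𝒰)
    (hreal : ∀ z ∈ 𝒰, z.im ≠ 0) {F : ℂ → ℍ[ℂ]} (hF : IsStem 𝒰 F)
    (hc : ContinuousOn (fun z => coords (F z)) (upper 𝒰)) : Continuous (sliceOf 𝒰 F) := by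
  have hmem : ∀ q : circ 𝒰, (⟨q.1.re, imNorm q.1⟩ : ℂ) ∈ upper 𝒰 := fun q =>
    mem_upper_of_mem_circ hsymm hreal q.2
  have hne : ∀ q : circ 𝒰, imNorm q.1 ≠ 0 := fun q => (hmem q).2.ne'
  have heq : sliceOf 𝒰 F = fun q => evalAt (F ⟨q.1.re, imNorm q.1⟩) (imDir q.1) := by
    funext q
    have hp := point_imDir (hne q)
    have hm : point ⟨q.1.re, imNorm q.1⟩ (imDir q.1) ∈ circ 𝒰 := hp.symm ▸ q.2
    rw [← sliceOf_point hF (hmem q).1 (imDir_mem (hne q)) hm]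
    congr 1
    exact Subtype.ext hp.symm
  have c0 : Continuous fun q : circ 𝒰 => q.1.re :=
    Quaternion.continuous_re.comp continuous_subtype_val
  have c1 : Continuous fun q : circ 𝒰 => q.1.imI :=
    Quaternion.continuous_imI.comp continuous_subtype_val
  have c2 : Continuous fun q : circ 𝒰 => q.1.imJ :=
    Quaternion.continuous_imJ.comp continuous_subtype_val
  have c3 : Continuous fun q : circ 𝒰 => q.1.imK :=
    Quaternion.continuous_imK.comp continuous_subtype_val
  have cn : Continuous fun q : circ 𝒰 => imNorm q.1 := continuous_imNorm.comp continuous_subtype_val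
  have cz : Continuous fun q : circ 𝒰 => (⟨q.1.re, imNorm q.1⟩ : ℂ) :=
    Complex.equivRealProdCLM.symm.continuous.comp (c0.prodMk cn)
  obtain ⟨f0, f1, f2, f3⟩ := continuousOn_coords_iff.mp hc
  have g0 := f0.comp_continuous cz hmem
  have g1 := f1.comp_continuous cz hmem
  have g2 := f2.comp_continuous cz hmem
  have g3 := f3.comp_continuous cz hmem
  have r0 := Complex.continuous_re.comp g0
  have r1 := Complex.continuous_re.comp g1
  have r2 := Complex.continuous_re.comp g2
  have r3 := Complex.continuous_re.comp g3
  have i0 := Complex.continuous_im.comp g0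
  have i1 := Complex.continuous_im.comp g1
  have i2 := Complex.continuous_im.comp g2
  have i3 := Complex.continuous_im.comp g3
  have d1 := c1.div cn hne
  have d2 := c2.div cn hne
  have d3 := c3.div cn hne
  simp only [Function.comp_def] at r0 r1 r2 r3 i0 i1 i2 i3
  rw [heq, continuous_quaternion_iff]
  simp only [evalAt, imDir_re, imDir_imI, imDir_imJ, imDir_imK, Quaternion.re_add, Quaternion.imI_add, Quaternion.imJ_add,
    Quaternion.imK_add, Quaternion.re_mul, Quaternion.imI_mul, Quaternion.imJ_mul,
    Quaternion.imK_mul, realPart_re, realPart_imI, realPart_imJ, realPart_imK, imagPart_re,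
    imagPart_imI, imagPart_imJ, imagPart_imK]
  refine ⟨?_, ?_, ?_, ?_⟩ <;> fun_prop

/-- The values at `I = i` and `I = -i` determine the stem: half their sum is `F₀` and half their
difference is `i F₁`. -/
theorem continuousOn_coords_of_continuous_sliceOf {𝒰 : Set ℂ} {F : ℂ → ℍ[ℂ]} (hF : IsStem 𝒰 F)
    (hc : Continuous (sliceOf 𝒰 F)) : ContinuousOn (fun z => coords (F z)) 𝒰 := by
  have key : ∀ I ∈ imagUnits, Continuous fun z : 𝒰 => evalAt (F z) I := by
    intro I hI
    have hp : Continuous fun z : ℂ => point z I := by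
      unfold point
      have := Quaternion.continuous_coe
      have := Complex.continuous_re
      have := Complex.continuous_im
      fun_prop
    have hm : ∀ z : 𝒰, point z I ∈ circ 𝒰 := fun z => ⟨z, z.2, I, hI, rfl⟩
    have : (fun z : 𝒰 => evalAt (F z) I) = fun z : 𝒰 => sliceOf 𝒰 F ⟨point z I, hm z⟩ :=
      funext fun z => (sliceOf_point hF z.2 hI (hm z)).symm
    rw [this]
    exact hc.comp ((hp.comp continuous_subtype_val).subtype_mk hm)
  obtain ⟨i, h0, h1, h2, h3⟩ : ∃ i : ℍ[ℝ], i.re = 0 ∧ i.imI = 1 ∧ i.imJ = 0 ∧ i.imK = 0 :=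
    ⟨⟨0, 1, 0, 0⟩, rfl, rfl, rfl, rfl⟩
  have k1 := key i (imagUnits_iff.mpr (by simp [h0, h1, h2, h3]))
  have k2 := key (-i) (imagUnits_iff.mpr (by simp [h0, h1, h2, h3]))
  rw [continuous_quaternion_iff] at k1 k2
  simp [evalAt, h0, h1, h2, h3] at k1 k2
  obtain ⟨a0, a1, a2, a3⟩ := k1
  obtain ⟨b0, b1, b2, b3⟩ := k2
  have of_parts : ∀ {g : ℂ → ℂ} {u v : 𝒰 → ℝ}, Continuous u → Continuous v →
      (∀ z : 𝒰, (g z).re = u z) → (∀ z : 𝒰, (g z).im = v z) → ContinuousOn g 𝒰 := by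
    intro g u v hu hv hr hi
    rw [continuousOn_iff_continuous_domRestrict]
    have : 𝒰.domRestrict g = fun z => ((u z : ℂ) + v z * Complex.I) := by
      funext z
      apply Complex.ext <;> simp [hr, hi]
    rw [this]
    fun_prop
  rw [continuousOn_coords_iff]
  -- Left multiplication by `i` permutes the components of `F₁` up to sign, which explains the mixed
  -- indices and reversed differences in the imaginary parts.
  refine ⟨of_parts ((a0.add b0).div_const 2) ((a1.sub b1).div_const 2) ?_ ?_,
    of_parts ((a1.add b1).div_const 2) ((b0.sub a0).div_const 2) ?_ ?_,
    of_parts ((a2.add b2).div_const 2) ((a3.sub b3).div_const 2) ?_ ?_,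
    of_parts ((a3.add b3).div_const 2) ((b2.sub a2).div_const 2) ?_ ?_⟩ <;>
  · intro z
    simp
    try ring

/-! ### Branches of roots on `𝒰⁺`. -/

/-- A pointwise `n`-th root of `g`, continuous on the simply connected open set `U` if `g` is
continuous and nonvanishing there. -/
theorem exists_root {U : Set ℂ} (hsc : IsSimplyConnected U) (hU : IsOpen U) {g : ℂ → ℂ}
    (h0 : ∀ z ∈ U, g z ≠ 0) {n : ℕ} (hn : n ≠ 0) :
    ∃ r : ℂ → ℂ, (∀ z, r z ^ n = g z) ∧ (ContinuousOn g U → ContinuousOn r U) := by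
  by_cases hg : ContinuousOn g U
  · obtain ⟨r, hr, h⟩ := Complex.exists_continuousOn_pow_eq hsc hU hg
      (by rintro ⟨z, hz, e⟩; exact h0 z hz e) hn
    exact ⟨r, h, fun _ => hr⟩
  -- For discontinuous `g` any pointwise choice will do, as the continuity clause is vacuous.
  · choose r hr using fun z => IsAlgClosed.exists_pow_nat_eq (g z) (Nat.pos_of_ne_zero hn)
    exact ⟨r, hr, fun h => absurd h hg⟩

/-- The product of the two eigenvalues is `z₀² + z₁² + z₂² + z₃²`. -/
theorem add_mul_I_ne_zero {w : ℍ[ℂ]} (hw : w ∈ Omega) {s : ℂ} (hs : s ^ 2 = vecSq w) :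
    w.re + Complex.I * s ≠ 0 ∧ w.re - Complex.I * s ≠ 0 := by
  have h : (w.re + Complex.I * s) * (w.re - Complex.I * s) ≠ 0 := by
    have : (w.re + Complex.I * s) * (w.re - Complex.I * s) = w.re ^ 2 + vecSq w := by
      rw [← hs]; linear_combination (-s ^ 2) * Complex.I_sq
    rw [this]
    exact hw.2.1
  exact mul_ne_zero_iff.mp h

section Branches

variable {U : Set ℂ} {F : ℂ → ℍ[ℂ]} {s a b : ℂ → ℂ}

theorem continuousOn_ofEigen (hF : ContinuousOn (fun z => coords (F z)) U)
    (hs : ContinuousOn s U) (ha : ContinuousOn a U) (hb : ContinuousOn b U)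
    (h0 : ∀ z ∈ U, s z ≠ 0) :
    ContinuousOn (fun z => coords (ofEigen (F z) (s z) (a z) (b z))) U := by
  obtain ⟨-, f1, f2, f3⟩ := continuousOn_coords_iff.mp hF
  have hq : ContinuousOn (fun z => (a z - b z) / (2 * Complex.I * s z)) U :=
    (ha.sub hb).div (continuousOn_const.mul hs) fun z hz =>
      mul_ne_zero (mul_ne_zero two_ne_zero Complex.I_ne_zero) (h0 z hz)
  exact continuousOn_coords_iff.mpr
    ⟨(ha.add hb).div_const 2, hq.mul f1, hq.mul f2, hq.mul f3⟩

theorem differentiableOn_ofEigen (hF : DifferentiableOn ℂ (fun z => coords (F z)) U)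
    (hs : DifferentiableOn ℂ s U) (ha : DifferentiableOn ℂ a U) (hb : DifferentiableOn ℂ b U)
    (h0 : ∀ z ∈ U, s z ≠ 0) :
    DifferentiableOn ℂ (fun z => coords (ofEigen (F z) (s z) (a z) (b z))) U := by
  obtain ⟨-, f1, f2, f3⟩ := differentiableOn_coords_iff.mp hF
  have hq : DifferentiableOn ℂ (fun z => (a z - b z) / (2 * Complex.I * s z)) U :=
    (ha.sub hb).div ((differentiableOn_const _).mul hs) fun z hz =>
      mul_ne_zero (mul_ne_zero two_ne_zero Complex.I_ne_zero) (h0 z hz)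
  exact differentiableOn_coords_iff.mpr
    ⟨(ha.add hb).div_const 2, hq.mul f1, hq.mul f2, hq.mul f3⟩

theorem continuousOn_eigen {H : ℂ → ℍ[ℂ]} (hF : ContinuousOn (fun z => coords (F z)) U)
    (hH : ContinuousOn (fun z => coords (H z)) U) (hs : ContinuousOn s U)
    (h0 : ∀ z ∈ U, s z ≠ 0) : ContinuousOn (fun z => eigen (F z) (s z) (H z)) U := by
  obtain ⟨-, f1, f2, f3⟩ := continuousOn_coords_iff.mp hF
  obtain ⟨g0, g1, g2, g3⟩ := continuousOn_coords_iff.mp hH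
  exact g0.add (continuousOn_const.mul
    ((((f1.mul g1).add (f2.mul g2)).add (f3.mul g3)).div hs h0))

end Branches

end SliceFun

end

/-! ### Assembly of the `k²` roots. -/

open SliceFun in
theorem mainTheorem3 (k : ℕ) (hk : 1 ≤ k) (𝒰 : Set ℂ) (hopen : IsOpen 𝒰)
    (hsymm : ∀ z ∈ 𝒰, (starRingEnd ℂ) z ∈ 𝒰) (hreal : ∀ z ∈ 𝒰, z.im ≠ 0)
    (hsc : IsSimplyConnected (SliceFun.upper 𝒰))
    (F : ℂ → Quaternion ℂ) (hF : SliceFun.IsStem 𝒰 F)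
    (hΩ : ∀ z ∈ 𝒰, F z ∈ SliceFun.Omega)
    (f : SliceFun.circ 𝒰 → Quaternion ℝ) (hf : f = SliceFun.sliceOf 𝒰 F) :
    ∃ g : Fin (k ^ 2) → SliceFun.circ 𝒰 → Quaternion ℝ,
      Function.Injective g ∧
      (∀ m, SliceFun.IsSlice 𝒰 (g m) ∧ SliceFun.starPow 𝒰 (g m) k = f) ∧
      (Continuous f →
        (∀ m, Continuous (g m)) ∧
        (∀ h : SliceFun.circ 𝒰 → Quaternion ℝ, SliceFun.IsSlice 𝒰 h → Continuous h →
          SliceFun.starPow 𝒰 h k = f → ∃ m, h = g m) ∧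
        (∀ m, ∃ G : ℂ → Quaternion ℂ,
          ContinuousOn (fun z => SliceFun.coords (G z)) (SliceFun.upper 𝒰) ∧
          (∀ z ∈ SliceFun.upper 𝒰, SliceFun.sigma k (G z) = F z) ∧
          g m = SliceFun.sliceOf 𝒰 (SliceFun.glue G))) ∧
      (SliceFun.IsSliceRegular 𝒰 f → ∀ m, SliceFun.IsSliceRegular 𝒰 (g m)) := by
  subst hf
  have hk0 : k ≠ 0 := Nat.one_le_iff_ne_zero.mp hk
  have hV := isOpen_upper hopen
  have hVΩ : ∀ z ∈ upper 𝒰, F z ∈ Omega := fun z hz => hΩ z hz.1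
  obtain ⟨s, hs, hsc'⟩ := exists_root hsc hV (g := fun z => vecSq (F z))
    (fun z hz => (hVΩ z hz).1) two_ne_zero
  have hs0 : ∀ z ∈ upper 𝒰, s z ≠ 0 := fun z hz h =>
    (hVΩ z hz).1 (by rw [← vecSq, ← hs z, h]; simp)
  have hne := fun z hz => add_mul_I_ne_zero (hVΩ z hz) (hs z)
  obtain ⟨a, ha, hac⟩ := exists_root hsc hV (g := fun z => (F z).re + Complex.I * s z)
    (fun z hz => (hne z hz).1) hk0
  obtain ⟨b, hb, hbc⟩ := exists_root hsc hV (g := fun z => (F z).re - Complex.I * s z)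
    (fun z hz => (hne z hz).2) hk0
  have ha0 : ∀ z ∈ upper 𝒰, a z ≠ 0 := fun z hz h =>
    (hne z hz).1 (by rw [← ha z, h, zero_pow hk0])
  have hb0 : ∀ z ∈ upper 𝒰, b z ≠ 0 := fun z hz h =>
    (hne z hz).2 (by rw [← hb z, h, zero_pow hk0])
  obtain ⟨ζ, hζ⟩ : ∃ ζ : ℂ, IsPrimitiveRoot ζ k := ⟨_, Complex.isPrimitiveRoot_exp k hk0⟩
  have hζk : ∀ i : ℕ, (ζ ^ i) ^ k = 1 := fun i => by
    rw [← pow_mul, mul_comm, pow_mul, hζ.pow_eq_one, one_pow]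
  -- The two eigenvalue roots are twisted independently, whence `k * k` branches.
  let G : Fin k × Fin k → ℂ → ℍ[ℂ] := fun p z =>
    ofEigen (F z) (s z) (ζ ^ (p.1 : ℕ) * a z) (ζ ^ (p.2 : ℕ) * b z)
  have hGpow : ∀ p, ∀ z ∈ upper 𝒰, G p z ^ k = F z := by
    intro p z hz
    rw [ofEigen_pow (hs z) (hs0 z hz), mul_pow, mul_pow, hζk, hζk, one_mul, one_mul, ha, hb,
      ofEigen_self (hs0 z hz)]
  have hst : ∀ p, IsStem 𝒰 (glue (G p)) := fun p => isStem_glue hreal (G p)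
  have hgl : ∀ p, ∀ z ∈ upper 𝒰, glue (G p) z = G p z := fun p z hz => glue_of_im_pos hz.2
  have hcont : ContinuousOn (fun z => coords (F z)) (upper 𝒰) →
      ContinuousOn s (upper 𝒰) ∧ ContinuousOn a (upper 𝒰) ∧ ContinuousOn b (upper 𝒰) := by
    intro hc
    obtain ⟨f0, f1, f2, f3⟩ := continuousOn_coords_iff.mp hc
    have hcs := hsc' (((f1.pow 2).add (f2.pow 2)).add (f3.pow 2))
    exact ⟨hcs, hac (f0.add (continuousOn_const.mul hcs)),
      hbc (f0.sub (continuousOn_const.mul hcs))⟩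
  have hGc : ContinuousOn (fun z => coords (F z)) (upper 𝒰) → ∀ p,
      ContinuousOn (fun z => coords (G p z)) (upper 𝒰) := by
    intro hc p
    obtain ⟨hcs, hca, hcb⟩ := hcont hc
    exact continuousOn_ofEigen hc hcs (continuousOn_const.mul hca) (continuousOn_const.mul hcb) hs0
  have hsub : upper 𝒰 ⊆ 𝒰 := fun z hz => hz.1
  let e : Fin (k ^ 2) ≃ Fin k × Fin k := (finCongr (sq k)).trans finProdFinEquiv.symm
  refine ⟨fun m => sliceOf 𝒰 (glue (G (e m))), ?_, ?_, ?_, ?_⟩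
  · intro m n hmn
    apply e.injective
    -- A single point of `𝒰⁺` separates the branches: the eigenvalues there recover both exponents,
    -- since `a` and `b` do not vanish.
    obtain ⟨z, hz⟩ := hsc.nonempty
    have h := stem_unique (hst _) (hst _) hmn hz.1
    rw [hgl _ z hz, hgl _ z hz] at h
    have h1 := congrArg (eigen (F z) (s z)) h
    have h2 := congrArg (eigen (F z) (-s z)) h
    rw [eigen_ofEigen (hs z) (hs0 z hz), eigen_ofEigen (hs z) (hs0 z hz)] at h1
    rw [eigen_neg_ofEigen (hs z) (hs0 z hz), eigen_neg_ofEigen (hs z) (hs0 z hz)] at h2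
    exact Prod.ext
      (Fin.ext (hζ.pow_inj (Fin.is_lt _) (Fin.is_lt _) (mul_right_cancel₀ (ha0 z hz) h1)))
      (Fin.ext (hζ.pow_inj (Fin.is_lt _) (Fin.is_lt _) (mul_right_cancel₀ (hb0 z hz) h2)))
  · intro m
    refine ⟨⟨_, hst _, rfl⟩, ?_⟩
    rw [starPow_sliceOf (hst _)]
    refine sliceOf_congr (IsStem.eqOn hsymm hreal ((hst _).pow k) hF fun z hz => ?_)
    rw [hgl _ z hz, hGpow _ z hz]
  · intro hfc
    have hc := (continuousOn_coords_of_continuous_sliceOf hF hfc).mono hsub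
    refine ⟨fun m => ?_, ?_, fun m => ⟨G (e m), hGc hc _, hGpow _, rfl⟩⟩
    · exact continuous_sliceOf hsymm hreal (hst _)
        ((hGc hc _).congr fun z hz => congrArg coords (hgl _ z hz))
    · rintro h ⟨H, hH, rfl⟩ hhc hpow
      have hHc := (continuousOn_coords_of_continuous_sliceOf hH hhc).mono hsub
      obtain ⟨hcs, hca, hcb⟩ := hcont hc
      rw [starPow_sliceOf hH] at hpow
      have hHk : ∀ z ∈ upper 𝒰, H z ^ k = F z := fun z hz =>
        stem_unique (hH.pow k) hF hpow hz.1
      have hV' : IsPreconnected (upper 𝒰) := hsc.isPathConnected.isConnected.isPreconnected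
      -- The two eigenvalues of `H` are continuous `k`-th roots of those of `F`, so each is a
      -- constant root of unity times `a` or `b`.
      obtain ⟨i, hi⟩ := exists_eq_pow_mul hV' hk0 hζ hca (continuousOn_eigen hc hHc hcs hs0) ha0
        fun z hz => (eigen_pow (hs z) (hs0 z hz) (hHk z hz)).1.trans (ha z).symm
      obtain ⟨j, hj⟩ := exists_eq_pow_mul hV' hk0 hζ hcb
        (continuousOn_eigen hc hHc hcs.neg fun z hz => neg_ne_zero.mpr (hs0 z hz)) hb0
        fun z hz => (eigen_pow (hs z) (hs0 z hz) (hHk z hz)).2.trans (hb z).symm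
      refine ⟨e.symm (i, j), sliceOf_congr (IsStem.eqOn hsymm hreal hH (hst _) fun z hz => ?_)⟩
      rw [hgl _ z hz, e.apply_symm_apply]
      have hcomm : Commute (F z) (H z) := hHk z hz ▸ Commute.pow_self (H z) k
      rw [← ofEigen_eigen (hs z) (hs0 z hz) hcomm]
      simp only [G]
      rw [← hi z hz, ← hj z hz]
      rfl
  · rintro ⟨F', hF', hd', he⟩ m
    -- Regularity supplies some holomorphic stem `F'`; uniqueness of stems transfers holomorphy to
    -- `F`.
    have hd : DifferentiableOn ℂ (fun z => coords (F z)) (upper 𝒰) :=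
      (hd'.congr fun z hz => congrArg coords (stem_unique hF hF' he hz)).mono hsub
    obtain ⟨hcs, hca, hcb⟩ := hcont hd.continuousOn
    obtain ⟨f0, f1, f2, f3⟩ := differentiableOn_coords_iff.mp hd
    -- The square root `s` comes before `a` and `b`, because their `k`-th powers involve `s`.
    have hds : DifferentiableOn ℂ s (upper 𝒰) :=
      differentiableOn_of_pow hV two_ne_zero hcs hs0
        ((((f1.pow 2).add (f2.pow 2)).add (f3.pow 2)).congr fun z _ => hs z)
    have hda : DifferentiableOn ℂ a (upper 𝒰) :=
      differentiableOn_of_pow hV hk0 hca ha0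
        ((f0.add ((differentiableOn_const _).mul hds)).congr fun z _ => ha z)
    have hdb : DifferentiableOn ℂ b (upper 𝒰) :=
      differentiableOn_of_pow hV hk0 hcb hb0
        ((f0.sub ((differentiableOn_const _).mul hds)).congr fun z _ => hb z)
    exact ⟨_, hst _, differentiableOn_glue hopen hsymm hreal
      (differentiableOn_ofEigen hd hds ((differentiableOn_const _).mul hda)
        ((differentiableOn_const _).mul hdb) hs0), rfl⟩
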